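/- Let $d\in\{2,3\}$, let $\Omega\subset\mathbb R^d$ be a bounded domain with smooth boundary $\Gamma$ and outward unit normal $\mathbf n$, and let $\Omega_0\subset\Omega$ be open. Let $g_1,g_2\in L^\infty(\Gamma)$ be real-valued, and let $P=L^2(\Omega_0)$ or $P=H^1(\Omega_0)$ (real-valued functions), with inner product $(\cdot,\cdot)_P$. Call $p\in P$ an *exact source* if there is a weak solution $u\in H^1(\Omega)$ of $$-\Delta u+u=p\,\chi_{\Omega_0}\ \text{ in }\Omega,\qquad u=g_1\ \text{ and }\ \frac{\partial u}{\partial\mathbf n}=g_2\ \text{ on }\Gamma ,$$ that is, $u$ has trace $g_1$ on $\Gamma$ and $\int_\Omega(\nabla u\cdot\nabla\psi+u\psi)\,dx=\int_{\Omega_0}p\psi\,dx+\int_\Gamma g_2\psi\,ds$ for all $\psi\in H^1(\Omega)$. Assume that an exact source in $P$ exists (exact data). For $p\in P$ let $u=u(p)\in H^1(\Omega;\mathbb C)$ and $w=w(p)\in H^1(\Omega;\mathbb C)$ be the weak solutions of $$-\Delta u+u=p\,\chi_{\Omega_0}\ \text{ in }\Omega,\quad \frac{\partial u}{\partial\mathbf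 n}+iu=g_2+ig_1\ \text{ on }\Gamma;\qquad -\Delta w+w=\operatorname{Im}u\ \text{ in }\Omega,\quad \frac{\partial w}{\partial\mathbf n}+iw=0\ \text{ on }\Gamma .$$ Let $\nabla V(p)\in P$ be the gradient in $P$ of $V(p)=\tfrac12\|\operatorname{Im}u(p)\|_{L^2(\Omega)}^2$, that is, the element given by $(\nabla V(p),q)_P=\int_{\Omega_0}\operatorname{Im}w(p)\,q\,dx$ for all $q\in P$; for $P=L^2(\Omega_0)$ this is $\nabla V(p)=\operatorname{Im}w(p)|_{\Omega_0}$. Let $r>3$, $p_0,\dot p_0\in P$, and let $p:[1,\infty)\to P$ be a solution of $$\ddot p(t)+\frac rt\,\dot p(t)+\nabla V(p(t))=0\quad(t>1),\qquad p(1)=p_0,\quad \dot p(1)=\dot p_0 .$$ Then there is an exact source $\bar p\in P$ such that $p(t)$ converges weakly to $\bar p$ in $P$ as $t\to\infty$. -/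

import Mathlib

open MeasureTheory Filter Topology Set
open scoped ContDiff ENNReal ComplexConjugate InnerProductSpace

noncomputable section

namespace InverseSource

/-- The Euclidean space `ℝ^d`. -/
abbrev E (d : ℕ) : Type := EuclideanSpace ℝ (Fin d)

/-- The partial derivative `∂φ/∂x_i` (only applied to smooth `φ`). -/
def pderiv {d : ℕ} {F : Type*} [NormedAddCommGroup F] [NormedSpace ℝ F]
    (i : Fin d) (φ : E d → F) (x : E d) : F :=
  fderiv ℝ φ x (EuclideanSpace.single i 1)

/-- `Ω` is a bounded domain (non-empty connected open set) of `ℝ^d` with smooth boundary: near each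
boundary point a smooth diffeomorphism straightens the boundary and sends `Ω` to one side of it. -/
structure IsSmoothBoundedDomain {d : ℕ} (Ω : Set (E d)) : Prop where
  isOpen : IsOpen Ω
  isConnected : IsConnected Ω
  isBounded : Bornology.IsBounded Ω
  smooth_boundary : ∀ x ∈ frontier Ω, ∃ φ : OpenPartialHomeomorph (E d) (E d), ∃ i : Fin d,
    x ∈ φ.source ∧ ContDiffOn ℝ ∞ φ φ.source ∧ ContDiffOn ℝ ∞ φ.symm φ.target ∧
      ∀ y ∈ φ.source, (y ∈ Ω ↔ 0 < φ y i)

/-- The surface measure `ds` on the boundary `Γ` of `Ω`: the `(d-1)`-dimensional Hausdorff measure,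
normalised as Euclidean surface area. -/
def surf {d : ℕ} (Ω : Set (E d)) : Measure (E d) :=
  (Measure.euclideanHausdorffMeasure (d - 1)).restrict (frontier Ω)

/-- `L²(G; 𝕜)` for `G ⊆ ℝ^d`. -/
abbrev L2 (𝕜 : Type*) [RCLike 𝕜] {d : ℕ} (G : Set (E d)) : Type _ :=
  Lp 𝕜 2 (volume.restrict G)

/-- `L²(Γ; 𝕜)`, with `Γ` the boundary of `Ω`. -/
abbrev L2Bdry (𝕜 : Type*) [RCLike 𝕜] {d : ℕ} (Ω : Set (E d)) : Type _ :=
  Lp 𝕜 2 (surf Ω)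

/-- `v` is the weak partial derivative `∂u/∂x_i` in the open set `G`. -/
def IsWeakPartial {𝕜 : Type*} [RCLike 𝕜] {d : ℕ} (G : Set (E d)) (i : Fin d)
    (u v : L2 𝕜 G) : Prop :=
  ∀ φ : E d → ℝ, ContDiff ℝ ∞ φ → HasCompactSupport φ → tsupport φ ⊆ G →
    ∫ x in G, pderiv i φ x • u x = -∫ x in G, φ x • v x

/-- The tuples `(u, v₁, …, v_d)` of `L²` functions, with the norm `(‖u‖² + ∑ ‖v_i‖²)^{1/2}`. The
entry `u` has index `none`, the entry `v_i` has index `some i`. -/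
abbrev L2Tuple (𝕜 : Type*) [RCLike 𝕜] {d : ℕ} (G : Set (E d)) : Type _ :=
  PiLp 2 (fun _ : Option (Fin d) => L2 𝕜 G)

lemma integrable_smul_L2 {𝕜 : Type*} [RCLike 𝕜] {d : ℕ} {G : Set (E d)} {φ : E d → ℝ}
    (hφ : Continuous φ) (hc : HasCompactSupport φ) (u : L2 𝕜 G) :
    Integrable (fun x => φ x • u x) (volume.restrict G) := by
  have h1 : MemLp φ 2 (volume.restrict G) := hφ.memLp_of_hasCompactSupport hc
  exact memLp_one_iff_integrable.1 ((Lp.memLp u).smul h1)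

lemma pderiv_test {d : ℕ} {φ : E d → ℝ} (i : Fin d) (h : ContDiff ℝ ∞ φ)
    (hc : HasCompactSupport φ) :
    Continuous (pderiv i φ) ∧ HasCompactSupport (pderiv i φ) :=
  ⟨(h.continuous_fderiv (by simp)).clm_apply continuous_const, hc.fderiv_apply ℝ _⟩

/-- The Sobolev space `H¹(G; 𝕜)`: an element is a function `u` in `L²(G)` together with its weak
partial derivatives, which are in `L²(G)`. The inner product inherited from the space of tuples is
`⟪u, v⟫ = ∫_G (ū v + ∑ᵢ conj (∂ᵢu) ∂ᵢv) dx` (conjugate-linear in the first entry). -/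
def H1 (𝕜 : Type*) [RCLike 𝕜] {d : ℕ} (G : Set (E d)) : Submodule 𝕜 (L2Tuple 𝕜 G) where
  carrier := {u | ∀ i : Fin d, IsWeakPartial G i (u none) (u (some i))}
  zero_mem' := by
    intro i φ h hc hs
    have h0 : ((0 : L2 𝕜 G) : E d → 𝕜) =ᵐ[volume.restrict G] 0 := Lp.coeFn_zero 𝕜 2 _
    have e1 : ∫ x in G, pderiv i φ x • (0 : L2 𝕜 G) x = 0 :=
      integral_eq_zero_of_ae (by filter_upwards [h0] with x hx; rw [hx]; simp)
    have e2 : ∫ x in G, φ x • (0 : L2 𝕜 G) x = 0 :=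
      integral_eq_zero_of_ae (by filter_upwards [h0] with x hx; rw [hx]; simp)
    change ∫ x in G, pderiv i φ x • (0 : L2 𝕜 G) x = -∫ x in G, φ x • (0 : L2 𝕜 G) x
    rw [e1, e2, neg_zero]
  add_mem' := by
    intro u v hu hv i φ h hc hs
    obtain ⟨hd, hdc⟩ := pderiv_test i h hc
    have key : ∀ (ρ : E d → ℝ), Continuous ρ → HasCompactSupport ρ → ∀ a b : L2 𝕜 G,
        ∫ x in G, ρ x • (a + b) x = (∫ x in G, ρ x • a x) + ∫ x in G, ρ x • b x := by
      intro ρ hρ hρc a b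
      rw [← integral_add (integrable_smul_L2 hρ hρc a) (integrable_smul_L2 hρ hρc b)]
      refine integral_congr_ae ?_
      filter_upwards [Lp.coeFn_add a b] with x hx
      rw [hx]
      simp only [Pi.add_apply, smul_add]
    change ∫ x in G, pderiv i φ x • (u none + v none) x
      = -∫ x in G, φ x • (u (some i) + v (some i)) x
    rw [key _ hd hdc, key _ h.continuous hc, hu i φ h hc hs, hv i φ h hc hs]
    ring
  smul_mem' := by
    intro c u hu i φ h hc hs
    have key : ∀ (ρ : E d → ℝ) (a : L2 𝕜 G),
        ∫ x in G, ρ x • (c • a) x = c * ∫ x in G, ρ x • a x := by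
      intro ρ a
      rw [← integral_const_mul]
      refine integral_congr_ae ?_
      filter_upwards [Lp.coeFn_smul c a] with x hx
      simp [hx]
    change ∫ x in G, pderiv i φ x • (c • u none) x = -∫ x in G, φ x • (c • u (some i)) x
    rw [key, key, hu i φ h hc hs]
    ring

/-- The `L²` function underlying an element of `H¹(G)`. -/
def fn {𝕜 : Type*} [RCLike 𝕜] {d : ℕ} {G : Set (E d)} (u : H1 𝕜 G) : L2 𝕜 G :=
  (u : L2Tuple 𝕜 G) none

/-- The weak partial derivative `∂u/∂x_i` of `u` in `H¹(G)`. -/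
def wpartial {𝕜 : Type*} [RCLike 𝕜] {d : ℕ} {G : Set (E d)} (u : H1 𝕜 G) (i : Fin d) : L2 𝕜 G :=
  (u : L2Tuple 𝕜 G) (some i)

/-- `τ ∈ L²(Γ)` is the boundary trace of `u ∈ H¹(Ω)`: there are functions `φ_n`, smooth up to the
boundary, with `φ_n → u` in `H¹(Ω)` and `φ_n|_Γ → τ` in `L²(Γ)`. -/
def HasTrace {𝕜 : Type*} [RCLike 𝕜] {d : ℕ} {Ω : Set (E d)} (u : H1 𝕜 Ω) (τ : L2Bdry 𝕜 Ω) :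
    Prop :=
  ∃ φ : ℕ → E d → 𝕜, (∀ n, ContDiff ℝ ∞ (φ n)) ∧
    Tendsto (fun n => eLpNorm (fun x => φ n x - fn u x) 2 (volume.restrict Ω)) atTop (𝓝 0) ∧
    (∀ i, Tendsto (fun n => eLpNorm (fun x => pderiv i (φ n) x - wpartial u i x) 2
      (volume.restrict Ω)) atTop (𝓝 0)) ∧
    Tendsto (fun n => eLpNorm (fun x => φ n x - τ x) 2 (surf Ω)) atTop (𝓝 0)

/-- `p` is an exact source for the boundary data `(g₁, g₂)`: there is a (weak) solution
`u ∈ H¹(Ω)` of `-Δu + u = p χ_{Ω₀}` in `Ω`, `u = g₁` and `∂u/∂n = g₂` on `Γ`. -/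
def IsExactSource {d : ℕ} (Ω Ω₀ : Set (E d)) (g₁ g₂ : E d → ℝ) (p : L2 ℝ Ω₀) : Prop :=
  ∃ (u : H1 ℝ Ω) (τ : L2Bdry ℝ Ω), HasTrace u τ ∧ τ =ᵐ[surf Ω] g₁ ∧
    ∀ (ψ : H1 ℝ Ω) (τψ : L2Bdry ℝ Ω), HasTrace ψ τψ →
      ⟪u, ψ⟫_ℝ = (∫ x in Ω₀, p x * fn ψ x) + ∫ x, g₂ x * τψ x ∂(surf Ω)

/-- The sesquilinear form `a(u, ψ) = ∫_Ω (∇u · ∇ψ̄ + u ψ̄) dx + i ∫_Γ u ψ̄ ds`, for `u, ψ` in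
`H¹(Ω; ℂ)` with traces `τ, τψ`. -/
def form {d : ℕ} {Ω : Set (E d)} (u : H1 ℂ Ω) (τ : L2Bdry ℂ Ω) (ψ : H1 ℂ Ω) (τψ : L2Bdry ℂ Ω) :
    ℂ :=
  ⟪ψ, u⟫_ℂ + Complex.I * ∫ x, τ x * conj (τψ x) ∂(surf Ω)

/-- `u ∈ H¹(Ω; ℂ)` is the weak solution of the state problem
`-Δu + u = p χ_{Ω₀}` in `Ω`, `∂u/∂n + i u = g₂ + i g₁` on `Γ`. -/
def IsState {d : ℕ} (Ω Ω₀ : Set (E d)) (g₁ g₂ : E d → ℝ) (p : L2 ℝ Ω₀) (u : H1 ℂ Ω) : Prop :=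
  ∃ τ : L2Bdry ℂ Ω, HasTrace u τ ∧
    ∀ (ψ : H1 ℂ Ω) (τψ : L2Bdry ℂ Ω), HasTrace ψ τψ →
      form u τ ψ τψ = (∫ x in Ω₀, (p x : ℂ) * conj (fn ψ x))
        + (∫ x, (g₂ x : ℂ) * conj (τψ x) ∂(surf Ω))
        + Complex.I * ∫ x, (g₁ x : ℂ) * conj (τψ x) ∂(surf Ω)

/-- `w ∈ H¹(Ω; ℂ)` is the weak solution of the adjoint problem
`-Δw + w = u_im` in `Ω`, `∂w/∂n + i w = 0` on `Γ`. -/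
def IsAdjoint {d : ℕ} (Ω : Set (E d)) (u w : H1 ℂ Ω) : Prop :=
  ∃ τ : L2Bdry ℂ Ω, HasTrace w τ ∧
    ∀ (ψ : H1 ℂ Ω) (τψ : L2Bdry ℂ Ω), HasTrace ψ τψ →
      form w τ ψ τψ = ∫ x in Ω, ((fn u x).im : ℂ) * conj (fn ψ x)

/-- Let `P` be a Hilbert space of source functions and `ι : P → L²(Ω₀)` its inclusion.
`p : [1, ∞) → P` solves
`p'' + (r / t) p' + ∇V(p) = 0` for `t > 1`, `p(1) = p₀`, `p'(1) = p₁`,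
where `V(p) = ½ ‖u_im‖²_{L²(Ω)}`, `u = u(t)` solves the state problem for the source `p(t)` and
the gradient `∇V(p(t)) = G(t) ∈ P` is the element which represents `w_im`, with `w = w(t)` the
solution of the adjoint problem: `(G(t), q)_P = ∫_{Ω₀} w_im q dx` for all `q ∈ P`.
In the case `P = L²(Ω₀)` this says `G(t) = w_im(t)|_{Ω₀}`. -/
def IsNesterovFlow {d : ℕ} (Ω Ω₀ : Set (E d)) (g₁ g₂ : E d → ℝ) (r : ℝ)
    {P : Type*} [NormedAddCommGroup P] [InnerProductSpace ℝ P] (ι : P → L2 ℝ Ω₀)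
    (p₀ p₁ : P) (p : ℝ → P) : Prop :=
  ∃ (p' p'' G : ℝ → P) (u w : ℝ → H1 ℂ Ω),
    ContinuousOn p (Ici 1) ∧ ContinuousOn p' (Ici 1) ∧ p 1 = p₀ ∧ p' 1 = p₁ ∧
    ∀ t : ℝ, 1 < t →
      HasDerivAt p (p' t) t ∧ HasDerivAt p' (p'' t) t ∧
      p'' t + (r / t) • p' t + G t = 0 ∧
      (∀ q : P, ⟪G t, q⟫_ℝ = ∫ x in Ω₀, (fn (w t) x).im * ι q x) ∧
      IsState Ω Ω₀ g₁ g₂ (ι (p t)) (u t) ∧ IsAdjoint Ω (u t) (w t)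

end InverseSource

end

/-! Let `ps` be an exact source and put `x = p - ps`. The real and imaginary parts `(v₁, v₂)` of the
difference between the state and the exact solution satisfy a linear system in which the boundary
data cancel, and `Im u = A x` for a bounded operator `A`. The adjoint problem has the same form. The
operator taking a right-hand side to `v₂` is self-adjoint (`exists_solutionOperator`), so `∇V(p) =
A* A x` and the flow reads `x'' + (r / t) x' + A* A x = 0`.

For `r > 3` the function `flowEnergy` is nonincreasing, which bounds `x` and gives `‖A x‖ = O(1 /
t)`. On `ker A` the force disappears, and the projected equation integrates explicitly to a strong
limit `l`. The complement `(ker A)ᗮ` is the closure of the range of `A*`; there `⟪x, A* y⟫ = ⟪A x,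
y⟫ → 0` and boundedness give weak convergence to `0`. Finally `A l = 0` forces `v₂` and both traces
to vanish, so `ps + l` is an exact source.

Traces are handled as a relation with closed graph. The inner product of this graph is the sum of
the two forms in the system, so their operators satisfy `b + c = 1`; hence they commute, and `b² +
c²` is coercive. -/

noncomputable section

namespace InverseSource

/-! ### The damped flow `x'' + (r / t) x' + A* A x = 0` -/

/-- Without a force, the damped flow converges. -/
lemma exists_tendsto_of_damped {P : Type*} [NormedAddCommGroup P] [NormedSpace ℝ P] {r : ℝ}
    {z z' z'' : ℝ → P} (hr : 1 < r)
    (hz : ∀ t, 1 < t → HasDerivAt z (z' t) t) (hz' : ∀ t, 1 < t → HasDerivAt z' (z'' t) t)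
    (heq : ∀ t, 1 < t → z'' t + (r / t) • z' t = 0) : ∃ l, Tendsto z atTop (𝓝 l) := by
  have hconst : ∀ f : ℝ → P, (∀ t, 1 < t → HasDerivAt f 0 t) → ∀ t, 1 < t → f t = f 2 := by
    intro f hf t ht
    exact isOpen_Ioi.is_const_of_deriv_eq_zero isPreconnected_Ioi
      (fun s hs => (hf s hs).differentiableAt.differentiableWithinAt)
      (fun s hs => (hf s hs).deriv) ht (mem_Ioi.2 one_lt_two)
  -- With the integrating factor `t ^ r`, the quantity `t ^ r z'` is conserved. The base point 2
  -- lies inside `(1, ∞)`, where the equation holds.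
  set c : P := (2 : ℝ) ^ r • z' 2
  have hc : ∀ t : ℝ, 1 < t → t ^ r • z' t = c := by
    refine hconst (fun t => t ^ r • z' t) fun t ht => ?_
    have ht0 : 0 < t := by linarith
    refine ((Real.hasDerivAt_rpow_const (Or.inl ht0.ne')).smul (hz' t ht)).congr_deriv ?_
    have : r * t ^ (r - 1) = t ^ r * (r / t) := by
      rw [Real.rpow_sub_one ht0.ne']; ring
    rw [this, ← smul_smul, ← smul_add, heq t ht, smul_zero]
  have hr1 : r - 1 ≠ 0 := by linarith
  have hr2 : 1 - r ≠ 0 := by linarith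
  have hl := hconst (fun t => z t + (t ^ (1 - r) / (r - 1)) • c) fun t ht => by
    have ht0 : 0 < t := by linarith
    refine ((hz t ht).add (((Real.hasDerivAt_rpow_const (p := 1 - r)
      (Or.inl ht0.ne')).div_const (r - 1)).smul_const c)).congr_deriv ?_
    have h1 : (1 - r) * t ^ (1 - r - 1) / (r - 1) = -(t ^ r)⁻¹ := by
      rw [show 1 - r - 1 = -r by ring, Real.rpow_neg ht0.le]
      field_simp
      ring
    rw [h1, ← hc t ht, smul_smul, neg_mul, inv_mul_cancel₀ (Real.rpow_pos_of_pos ht0 r).ne']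
    simp
  refine ⟨_, (?_ : Tendsto z atTop (𝓝 (z 2 + ((2 : ℝ) ^ (1 - r) / (r - 1)) • c)))⟩
  have h0 : Tendsto (fun t : ℝ => (t ^ (1 - r) / (r - 1)) • c) atTop (𝓝 0) := by
    have h1 : Tendsto (fun t : ℝ => t ^ (1 - r)) atTop (𝓝 0) := by
      rw [show 1 - r = -(r - 1) by ring]
      exact tendsto_rpow_neg_atTop (by linarith)
    simpa using (h1.div_const (r - 1)).smul_const c
  have h2 := (tendsto_const_nhds (x := z 2 + ((2 : ℝ) ^ (1 - r) / (r - 1)) • c)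
    (f := atTop (α := ℝ))).sub h0
  rw [sub_zero] at h2
  refine h2.congr' ?_
  filter_upwards [eventually_gt_atTop 1] with t ht
  rw [← hl t ht, add_sub_cancel_right]

section DampedFlow

variable {P Y : Type*} [NormedAddCommGroup P] [InnerProductSpace ℝ P] [CompleteSpace P]
  [NormedAddCommGroup Y] [InnerProductSpace ℝ Y] [CompleteSpace Y]

/-- `x'` and `x''` are the derivatives of `x`, which solves `x'' + (r / t) x' + A* A x = 0` on
`(1, ∞)`. -/
structure IsDampedFlow (A : P →L[ℝ] Y) (r : ℝ) (x x' x'' : ℝ → P) : Prop where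
  continuousOn : ContinuousOn x (Ici 1)
  continuousOn_deriv : ContinuousOn x' (Ici 1)
  hasDerivAt : ∀ t, 1 < t → HasDerivAt x (x' t) t
  hasDerivAt_deriv : ∀ t, 1 < t → HasDerivAt x' (x'' t) t
  equation : ∀ t, 1 < t → x'' t + (r / t) • x' t + A.adjoint (A (x t)) = 0

/-- The Lyapunov function of the damped flow. -/
def flowEnergy (A : P →L[ℝ] Y) (r : ℝ) (x x' : ℝ → P) (t : ℝ) : ℝ :=
  t ^ 2 / 2 * ‖A (x t)‖ ^ 2 + ‖(2 : ℝ) • x t + t • x' t‖ ^ 2 / 2 + (r - 3) * ‖x t‖ ^ 2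

variable {A : P →L[ℝ] Y} {r : ℝ} {x x' x'' : ℝ → P}

/-- By the equation, `2 x + t x'` has derivative `(3 - r) x' - t A* A x`. The term `(r - 3) ‖x‖²`
cancels the products `⟪x, x'⟫`, and the factor 2 turns `+t ‖A x‖²` into `-t ‖A x‖²`. -/
lemma IsDampedFlow.hasDerivAt_flowEnergy (h : IsDampedFlow A r x x' x'') {t : ℝ} (ht : 1 < t) :
    HasDerivAt (flowEnergy A r x x')
      (-(t * ‖A (x t)‖ ^ 2) - (r - 3) * t * ‖x' t‖ ^ 2) t := by
  have h1 := h.hasDerivAt t ht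
  have h2 := h.hasDerivAt_deriv t ht
  have hA : HasDerivAt (fun s => A (x s)) (A (x' t)) t := A.hasFDerivAt.comp_hasDerivAt t h1
  have d1 := (((hasDerivAt_id t).pow 2).div_const 2).mul hA.norm_sq
  have d2 := ((h1.const_smul (2 : ℝ)).add ((hasDerivAt_id t).smul h2)).norm_sq.div_const 2
  have d3 := h1.norm_sq.const_mul (r - 3)
  have ht0 : t ≠ 0 := by positivity
  have hx'' : t • x'' t = -(r • x' t) - t • A.adjoint (A (x t)) := by
    have := congrArg (fun y => t • y) (h.equation t ht)
    simp only [smul_add, smul_smul, smul_zero, mul_div_cancel₀ r ht0] at this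
    rw [← sub_eq_zero, ← this]; abel
  have e1 : ⟪x t, A.adjoint (A (x t))⟫_ℝ = ‖A (x t)‖ ^ 2 := by
    rw [ContinuousLinearMap.adjoint_inner_right, real_inner_self_eq_norm_sq]
  have e2 : ⟪x' t, A.adjoint (A (x t))⟫_ℝ = ⟪A (x t), A (x' t)⟫_ℝ := by
    rw [ContinuousLinearMap.adjoint_inner_right, real_inner_comm]
  refine ((d1.add d2).add d3).congr_deriv ?_
  simp only [id, Pi.add_apply, Pi.smul_apply, Pi.smul_apply', id, hx'']
  simp only [inner_add_left, inner_add_right, inner_sub_right, inner_neg_right, inner_smul_left,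
    inner_smul_right, e1, e2, real_inner_self_eq_norm_sq]
  simp
  ring

lemma IsDampedFlow.flowEnergy_le (h : IsDampedFlow A r x x' x'') (hr : 3 < r) {t : ℝ}
    (ht : 1 ≤ t) : flowEnergy A r x x' t ≤ flowEnergy A r x x' 1 := by
  have hanti : AntitoneOn (flowEnergy A r x x') (Ici 1) := by
    -- Continuity at the endpoint extends the monotonicity to `t = 1`, where no equation is imposed.
    refine antitoneOn_of_deriv_nonpos (convex_Ici 1) ?_ ?_ ?_
    · have hx := h.continuousOn
      have hx' := h.continuousOn_deriv
      unfold flowEnergy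
      fun_prop
    · intro s hs
      rw [interior_Ici] at hs
      exact (h.hasDerivAt_flowEnergy hs).differentiableAt.differentiableWithinAt
    · intro s hs
      rw [interior_Ici] at hs
      rw [(h.hasDerivAt_flowEnergy hs).deriv]
      have hs0 : (0 : ℝ) ≤ s := zero_le_one.trans (le_of_lt hs)
      have h3 : 0 ≤ r - 3 := by linarith
      have : 0 ≤ s * ‖A (x s)‖ ^ 2 := by positivity
      have : 0 ≤ (r - 3) * s * ‖x' s‖ ^ 2 := by positivity
      linarith
  exact hanti self_mem_Ici ht ht

lemma IsDampedFlow.exists_norm_le (h : IsDampedFlow A r x x' x'') (hr : 3 < r) :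
    ∃ C, ∀ t, 1 ≤ t → ‖x t‖ ≤ C := by
  refine ⟨√(flowEnergy A r x x' 1 / (r - 3)), fun t ht => Real.le_sqrt_of_sq_le ?_⟩
  have h3 : 0 < r - 3 := by linarith
  rw [le_div_iff₀ h3, mul_comm]
  have := h.flowEnergy_le hr ht
  rw [flowEnergy] at this
  have : 0 ≤ t ^ 2 / 2 * ‖A (x t)‖ ^ 2 := by positivity
  have : 0 ≤ ‖(2 : ℝ) • x t + t • x' t‖ ^ 2 / 2 := by positivity
  linarith

lemma IsDampedFlow.tendsto_apply (h : IsDampedFlow A r x x' x'') (hr : 3 < r) :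
    Tendsto (fun t => A (x t)) atTop (𝓝 0) := by
  have h3 : 0 < r - 3 := by linarith
  have hlim : Tendsto (fun t : ℝ => √(2 * flowEnergy A r x x' 1) / t) atTop (𝓝 0) :=
    tendsto_const_nhds.div_atTop tendsto_id
  refine squeeze_zero_norm' ?_ hlim
  filter_upwards [eventually_ge_atTop 1] with t ht
  have ht0 : 0 < t := by linarith
  rw [le_div_iff₀ ht0]
  refine Real.le_sqrt_of_sq_le ?_
  have := h.flowEnergy_le hr ht
  rw [flowEnergy] at this
  have : 0 ≤ (r - 3) * ‖x t‖ ^ 2 := by positivity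
  have : 0 ≤ ‖(2 : ℝ) • x t + t • x' t‖ ^ 2 / 2 := by positivity
  rw [mul_pow]
  linarith

/-- If `A x(t) → 0` and `x(t)` is bounded, `x(t)` converges weakly to `0` on `(ker A)ᗮ`. -/
lemma tendsto_inner_of_mem_orthogonal_ker {C : ℝ} (hC : ∀ t, 1 ≤ t → ‖x t‖ ≤ C)
    (hA : Tendsto (fun t => A (x t)) atTop (𝓝 0)) {q : P} (hq : q ∈ A.kerᗮ) :
    Tendsto (fun t => ⟪x t, q⟫_ℝ) atTop (𝓝 0) := by
  rw [ContinuousLinearMap.orthogonal_ker] at hq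
  rw [Metric.tendsto_nhds]
  intro ε hε
  have hC0 : 0 ≤ C := (norm_nonneg _).trans (hC 1 le_rfl)
  -- `q` is approximated by some `A* y`. Dividing by `C + 1` rather than `C` covers `C = 0`.
  obtain ⟨_, ⟨y, rfl⟩, hy⟩ := Metric.mem_closure_iff.1 hq (ε / 2 / (C + 1)) (by positivity)
  have h1 : Tendsto (fun t => ⟪A (x t), y⟫_ℝ) atTop (𝓝 0) := by
    simpa using hA.inner (tendsto_const_nhds (x := y))
  filter_upwards [Metric.tendsto_nhds.1 h1 (ε / 2) (by positivity), eventually_ge_atTop 1]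
    with t ht ht1
  rw [Real.dist_eq, sub_zero] at ht ⊢
  rw [dist_eq_norm] at hy
  have e : ⟪x t, q⟫_ℝ = ⟪A (x t), y⟫_ℝ + ⟪x t, q - A.adjoint y⟫_ℝ := by
    rw [inner_sub_right, ContinuousLinearMap.adjoint_inner_right]; ring
  have h2 : |⟪x t, q - A.adjoint y⟫_ℝ| ≤ ε / 2 := by
    refine (abs_real_inner_le_norm _ _).trans ?_
    calc ‖x t‖ * ‖q - A.adjoint y‖ ≤ (C + 1) * (ε / 2 / (C + 1)) :=
          mul_le_mul ((hC t ht1).trans (by linarith)) hy.le (norm_nonneg _) (by positivity)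
      _ = ε / 2 := by field_simp
  rw [e]
  calc _ ≤ _ := abs_add_le _ _
    _ < ε / 2 + ε / 2 := add_lt_add_of_lt_of_le ht h2
    _ = ε := by ring

/-- For `r > 3`, the damped flow converges weakly to a zero of `A`. -/
theorem IsDampedFlow.exists_weak_limit (h : IsDampedFlow A r x x' x'') (hr : 3 < r) :
    ∃ l : P, A l = 0 ∧ ∀ q, Tendsto (fun t => ⟪x t, q⟫_ℝ) atTop (𝓝 ⟪l, q⟫_ℝ) := by
  obtain ⟨C, hC⟩ := h.exists_norm_le hr
  have hA := h.tendsto_apply hr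
  have hcl : IsClosed (A.ker : Set P) := A.isClosed_ker
  have : CompleteSpace A.ker := hcl.completeSpace_coe
  set Q := A.ker.starProjection
  -- The range of `A*` is orthogonal to `ker A`, so the projected flow is force-free.
  have hQ : ∀ y, Q (A.adjoint y) = 0 := by
    intro y
    refine (A.ker.starProjection_apply_eq_zero_iff).2 ?_
    rw [ContinuousLinearMap.orthogonal_ker]
    exact subset_closure ⟨y, rfl⟩
  obtain ⟨l, hl⟩ := exists_tendsto_of_damped (r := r) (z := fun t => Q (x t))
    (z' := fun t => Q (x' t)) (z'' := fun t => Q (x'' t)) (by linarith)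
    (fun t ht => Q.hasFDerivAt.comp_hasDerivAt t (h.hasDerivAt t ht))
    (fun t ht => Q.hasFDerivAt.comp_hasDerivAt t (h.hasDerivAt_deriv t ht))
    (fun t ht => by simpa [hQ] using congrArg Q (h.equation t ht))
  have hlA : A l = 0 := hcl.mem_of_tendsto hl
    (Eventually.of_forall fun t => A.ker.starProjection_apply_mem (x t))
  have hlQ : Q l = l := A.ker.starProjection_eq_self_iff.2 hlA
  refine ⟨l, hlA, fun q => ?_⟩
  have h1 : Tendsto (fun t => ⟪Q (x t), q⟫_ℝ) atTop (𝓝 ⟪l, q⟫_ℝ) := hl.inner tendsto_const_nhds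
  have h2 := tendsto_inner_of_mem_orthogonal_ker hC hA (A.ker.sub_starProjection_mem_orthogonal q)
  have h3 := h1.add h2
  rw [add_zero] at h3
  refine h3.congr fun t => ?_
  rw [A.ker.inner_starProjection_left_eq_right, ← inner_add_right]
  congr 1
  abel

end DampedFlow

/-! ### The system `b v₁ - c v₂ = F`, `b v₂ + c v₁ = 0` -/

section MixedSystem

variable {H : Type*} [NormedAddCommGroup H] [InnerProductSpace ℝ H] [CompleteSpace H]

/-- For `b + c = 1`, the operator `b² + c²` is invertible, and its inverse commutes with `b`. -/
lemma exists_inverse_sq_add_sq {b c : H →L[ℝ] H} (hb : IsSelfAdjoint b) (hc : IsSelfAdjoint c)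
    (hbc : ∀ x, b x + c x = x) :
    ∃ T : H →L[ℝ] H, (∀ x, T (b (b x) + c (c x)) = x) ∧ (∀ x, b (b (T x)) + c (c (T x)) = x) ∧
      (∀ x, T (b x) = b (T x)) ∧ ∀ x, T (c x) = c (T x) := by
  set S : H →L[ℝ] H := b ∘L b + c ∘L c
  have hS : ∀ x, S x = b (b x) + c (c x) := fun x => rfl
  have hcb : ∀ x, c x = x - b x := fun x => by rw [eq_sub_iff_add_eq', hbc]
  have hsb := hb.isSymmetric
  have hsc := hc.isSymmetric
  -- The constant `1 / 2` comes from `‖x‖² ≤ (‖b x‖ + ‖c x‖)² ≤ 2 (‖b x‖² + ‖c x‖²)`.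
  have hcoer : IsCoercive ((innerSL ℝ).comp S) := by
    refine ⟨1 / 2, by norm_num, fun x => ?_⟩
    have e : ⟪S x, x⟫_ℝ = ‖b x‖ ^ 2 + ‖c x‖ ^ 2 := by
      rw [hS, inner_add_left, ← real_inner_self_eq_norm_sq, ← real_inner_self_eq_norm_sq]
      exact congrArg₂ (· + ·) (hsb (b x) x) (hsc (c x) x)
    have h2 : ‖x‖ ≤ ‖b x‖ + ‖c x‖ := by
      conv_lhs => rw [← hbc x]
      exact norm_add_le _ _
    change 1 / 2 * ‖x‖ * ‖x‖ ≤ ⟪S x, x⟫_ℝ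
    rw [e]
    nlinarith [norm_nonneg x, sq_nonneg (‖b x‖ - ‖c x‖)]
  set e := hcoer.continuousLinearEquivOfBilin
  have he : ∀ x, e x = S x := fun x => by
    refine ext_inner_right ℝ fun y => ?_
    rw [hcoer.continuousLinearEquivOfBilin_apply]
    rfl
  have hl : ∀ x, e.symm (S x) = x := fun x => by rw [← he, e.symm_apply_apply]
  have hr : ∀ x, S (e.symm x) = x := fun x => by rw [← he, e.apply_symm_apply]
  have hcomm : ∀ x, e.symm (b x) = b (e.symm x) := fun x => by
    have h1 : b x = S (b (e.symm x)) := by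
      conv_lhs => rw [← hr x]
      simp only [hS, hcb, map_add, map_sub]
    rw [h1, hl]
  refine ⟨(e.symm : H →L[ℝ] H), hl, hr, hcomm, fun x => ?_⟩
  change e.symm (c x) = c (e.symm x)
  rw [hcb, hcb, map_sub, hcomm]

/-- The solution operator `F ↦ v₂` of `b v₁ - c v₂ = F`, `b v₂ + c v₁ = 0` is self-adjoint. -/
theorem exists_solutionOperator {b c : H →L[ℝ] H} (hb : IsSelfAdjoint b) (hc : IsSelfAdjoint c)
    (hbc : ∀ x, b x + c x = x) :
    ∃ M : H →L[ℝ] H, IsSelfAdjoint M ∧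
      (∀ F, ∃ v, b v - c (M F) = F ∧ b (M F) + c v = 0) ∧
      ∀ F v₁ v₂, b v₁ - c v₂ = F → b v₂ + c v₁ = 0 → v₂ = M F := by
  obtain ⟨T, hl, hr, hTb, hTc⟩ := exists_inverse_sq_add_sq hb hc hbc
  have hcb : ∀ x, c x = x - b x := fun x => by rw [eq_sub_iff_add_eq', hbc]
  have hcomm : ∀ x, b (c x) = c (b x) := fun x => by simp only [hcb, map_sub]
  have hsb : ∀ x y, ⟪b x, y⟫_ℝ = ⟪x, b y⟫_ℝ := hb.isSymmetric
  have hsc : ∀ x y, ⟪c x, y⟫_ℝ = ⟪x, c y⟫_ℝ := hc.isSymmetric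
  -- The system is `(b + i c)(v₁ + i v₂) = F`. Since `b` and `c` commute, `v₁ + i v₂ = (b - i c)(b²
  -- + c²)⁻¹ F`.
  have hex : ∀ F, b (T (b F)) - c ((-(T ∘L c)) F) = F ∧ b ((-(T ∘L c)) F) + c (T (b F)) = 0 := by
    intro F
    simp only [neg_apply, ContinuousLinearMap.comp_apply, map_neg, hTb, hTc,
      sub_neg_eq_add, hr, hcomm, neg_add_cancel, and_self]
  refine ⟨-(T ∘L c), ?_, fun F => ⟨_, hex F⟩, fun F v₁ v₂ h1 h2 => ?_⟩
  · rw [ContinuousLinearMap.isSelfAdjoint_iff_isSymmetric]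
    intro F K
    change ⟪(-(T ∘L c)) F, K⟫_ℝ = ⟪F, (-(T ∘L c)) K⟫_ℝ
    obtain ⟨hF1, hF2⟩ := hex F
    obtain ⟨hK1, hK2⟩ := hex K
    set v₁ := T (b F)
    set w₁ := T (b K)
    set v₂ := (-(T ∘L c)) F
    set w₂ := (-(T ∘L c)) K
    have hv : b v₂ = -c v₁ := eq_neg_of_add_eq_zero_left hF2
    have hw : b w₂ = -c w₁ := eq_neg_of_add_eq_zero_left hK2
    -- Both sides reduce to `-⟪c v₁, w₁⟫ - ⟪c v₂, w₂⟫`, which is symmetric in the two solutions.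
    rw [← hF1, ← hK1, inner_sub_right, inner_sub_left, ← hsb, hv, hsb v₁, hw, inner_neg_left,
      inner_neg_right, hsc v₁, hsc v₂]
  · have : b (b v₂) + c (c v₂) = -c F := by
      rw [← h1, eq_neg_of_add_eq_zero_left h2, map_sub, map_neg, hcomm]
      abel
    rw [← hl v₂, this]
    simp

variable {V W : Type*} [NormedAddCommGroup V] [InnerProductSpace ℝ V] [CompleteSpace V]
  [NormedAddCommGroup W] [InnerProductSpace ℝ W] [CompleteSpace W]

/-- `v₁ + i v₂` solves `(α v, α k) + i (β v, β k) = (F, k)` for all real `k`. -/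
def IsFormSolution (α : H →L[ℝ] V) (β : H →L[ℝ] W) (F v₁ v₂ : H) : Prop :=
  (∀ k, ⟪α v₁, α k⟫_ℝ - ⟪β v₂, β k⟫_ℝ = ⟪F, k⟫_ℝ) ∧ ∀ k, ⟪α v₂, α k⟫_ℝ + ⟪β v₁, β k⟫_ℝ = 0

/-- With `b = α* α` and `c = β* β`, the variational identities become the operator system, and `hαβ`
becomes `b + c = 1`. -/
lemma exists_formSolutionOperator (α : H →L[ℝ] V) (β : H →L[ℝ] W)
    (hαβ : ∀ h k, ⟪h, k⟫_ℝ = ⟪α h, α k⟫_ℝ + ⟪β h, β k⟫_ℝ) :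
    ∃ M : H →L[ℝ] H, (∀ F K, ⟪M F, K⟫_ℝ = ⟪F, M K⟫_ℝ) ∧
      (∀ F, ∃ v, IsFormSolution α β F v (M F)) ∧
      ∀ F v₁ v₂, IsFormSolution α β F v₁ v₂ → v₂ = M F := by
  set b := α.adjoint ∘L α
  set c := β.adjoint ∘L β
  have hb : ∀ h k, ⟪b h, k⟫_ℝ = ⟪α h, α k⟫_ℝ := fun h k => α.adjoint_inner_left k (α h)
  have hc : ∀ h k, ⟪c h, k⟫_ℝ = ⟪β h, β k⟫_ℝ := fun h k => β.adjoint_inner_left k (β h)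
  have hbs : IsSelfAdjoint b := ContinuousLinearMap.isSelfAdjoint_iff_isSymmetric.2 fun h k =>
    (hb h k).trans (α.adjoint_inner_right h (α k)).symm
  have hcs : IsSelfAdjoint c := ContinuousLinearMap.isSelfAdjoint_iff_isSymmetric.2 fun h k =>
    (hc h k).trans (β.adjoint_inner_right h (β k)).symm
  have hbc : ∀ x, b x + c x = x := fun x => ext_inner_right ℝ fun k => by
    rw [inner_add_left, hb, hc, hαβ]
  have key : ∀ F v₁ v₂, IsFormSolution α β F v₁ v₂ ↔ b v₁ - c v₂ = F ∧ b v₂ + c v₁ = 0 := by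
    intro F v₁ v₂
    refine and_congr ⟨fun h => ext_inner_right ℝ fun k => ?_, fun h k => ?_⟩
      ⟨fun h => ext_inner_right ℝ fun k => ?_, fun h k => ?_⟩
    · rw [inner_sub_left, hb, hc, h]
    · rw [← h, inner_sub_left, hb, hc]
    · rw [inner_add_left, hb, hc, h, inner_zero_left]
    · rw [← hb v₂ k, ← hc v₁ k, ← inner_add_left, h, inner_zero_left]
  obtain ⟨M, hM, hex, huniq⟩ := exists_solutionOperator hbs hcs hbc
  exact ⟨M, hM.isSymmetric, fun F => (hex F).imp fun v hv => (key _ _ _).2 hv,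
    fun F v₁ v₂ h => huniq F v₁ v₂ ((key _ _ _).1 h).1 ((key _ _ _).1 h).2⟩

end MixedSystem

/-! ### The Sobolev space `H¹` and boundary traces -/

section Sobolev

variable {𝕜 𝕜' : Type*} [RCLike 𝕜] [RCLike 𝕜'] {d : ℕ}

lemma continuous_integral_smul_L2 {G : Set (E d)} {φ : E d → ℝ} (hφ : Continuous φ)
    (hc : HasCompactSupport φ) : Continuous fun u : L2 𝕜 G => ∫ x in G, φ x • u x := by
  have hm : MemLp (fun x => (φ x : 𝕜)) 2 (volume.restrict G) :=
    (hφ.memLp_of_hasCompactSupport (μ := volume.restrict G) hc).ofReal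
  have h : (fun u : L2 𝕜 G => ∫ x in G, φ x • u x) = fun u => ⟪hm.toLp _, u⟫_𝕜 := by
    funext u
    rw [L2.inner_def]
    refine integral_congr_ae ?_
    filter_upwards [hm.coeFn_toLp] with x hx
    rw [hx, RCLike.inner_apply, RCLike.conj_ofReal, RCLike.real_smul_eq_coe_mul, mul_comm]
  rw [h]
  fun_prop

/-- Each test function imposes a condition that is continuous in `L²`. -/
lemma isClosed_H1 (G : Set (E d)) : IsClosed (H1 𝕜 G : Set (L2Tuple 𝕜 G)) := by
  have : (H1 𝕜 G : Set (L2Tuple 𝕜 G)) = ⋂ (i : Fin d) (φ : E d → ℝ) (_ : ContDiff ℝ ∞ φ)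
      (_ : HasCompactSupport φ) (_ : tsupport φ ⊆ G),
      {u | ∫ x in G, pderiv i φ x • u none x = -∫ x in G, φ x • u (some i) x} := by
    ext u
    simp only [mem_iInter, mem_ofPred_eq]
    rfl
  rw [this]
  refine isClosed_iInter fun i => isClosed_iInter fun φ => isClosed_iInter fun h =>
    isClosed_iInter fun hc => isClosed_iInter fun hs => ?_
  obtain ⟨hd, hdc⟩ := pderiv_test i h hc
  exact isClosed_eq ((continuous_integral_smul_L2 hd hdc).comp (by fun_prop))
    ((continuous_integral_smul_L2 h.continuous hc).comp (by fun_prop)).neg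

instance completeSpace_H1 (G : Set (E d)) : CompleteSpace (H1 𝕜 G) :=
  (isClosed_H1 G).completeSpace_coe

/-- Evaluation of the underlying function, as a continuous linear map. -/
def fnL (𝕜 : Type*) [RCLike 𝕜] (G : Set (E d)) : H1 𝕜 G →L[𝕜] L2 𝕜 G :=
  (PiLp.proj 2 (fun _ : Option (Fin d) => L2 𝕜 G) none).comp (H1 𝕜 G).subtypeL

/-- The weak derivatives of the zero function vanish. -/
lemma eq_zero_of_fn_eq_zero {G : Set (E d)} (hG : IsOpen G) {u : H1 𝕜 G} (hu : fn u = 0) :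
    u = 0 := by
  refine Subtype.ext (PiLp.ext fun j => ?_)
  cases j with
  | none => exact hu
  | some i =>
    refine (Lp.eq_zero_iff_ae_eq_zero).2 ?_
    have hloc : LocallyIntegrableOn ((u : L2Tuple 𝕜 G) (some i)) G volume :=
      locallyIntegrableOn_of_locallyIntegrable_restrict
        ((Lp.memLp _).locallyIntegrable one_le_two)
    rw [Filter.EventuallyEq, ae_restrict_iff' hG.measurableSet]
    refine hG.ae_eq_zero_of_integral_contDiff_smul_eq_zero hloc fun φ h hc hs => ?_
    rw [← setIntegral_eq_integral_of_forall_compl_eq_zero (s := G) fun x hx => by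
      rw [image_eq_zero_of_notMem_tsupport fun hx' => hx (hs hx'), zero_smul]]
    have h0 : ∫ x in G, pderiv i φ x • fn u x = 0 := by
      refine integral_eq_zero_of_ae ?_
      filter_upwards [(Lp.eq_zero_iff_ae_eq_zero).1 hu] with x hx
      rw [hx]
      simp
    exact neg_eq_zero.1 ((u.2 i φ h hc hs).symm.trans h0)

/-- Composition of a function in `H¹(G; 𝕜)` with a real-linear map `𝕜 → 𝕜'`. -/
def mapH1 {G : Set (E d)} (L : 𝕜 →L[ℝ] 𝕜') (u : H1 𝕜 G) : H1 𝕜' G :=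
  ⟨WithLp.toLp 2 fun j => L.compLp ((u : L2Tuple 𝕜 G) j), by
    intro i φ h hc hs
    obtain ⟨hd, hdc⟩ := pderiv_test i h hc
    have key : ∀ (ρ : E d → ℝ), Continuous ρ → HasCompactSupport ρ → ∀ a : L2 𝕜 G,
        ∫ x in G, ρ x • L.compLp a x = L (∫ x in G, ρ x • a x) := by
      intro ρ hρ hρc a
      rw [← L.integral_comp_comm (integrable_smul_L2 hρ hρc a)]
      refine integral_congr_ae ?_
      filter_upwards [L.coeFn_compLp a] with x hx
      rw [hx, map_smul]
    change ∫ x in G, pderiv i φ x • L.compLp ((u : L2Tuple 𝕜 G) none) x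
      = -∫ x in G, φ x • L.compLp ((u : L2Tuple 𝕜 G) (some i)) x
    rw [key _ hd hdc, key _ h.continuous hc, u.2 i φ h hc hs, map_neg]⟩

lemma fn_mapH1 {G : Set (E d)} (L : 𝕜 →L[ℝ] 𝕜') (u : H1 𝕜 G) :
    fn (mapH1 L u) = L.compLp (fn u) := rfl

lemma tendsto_eLpNorm_comp {μ : Measure (E d)} (L : 𝕜 →L[ℝ] 𝕜') {f : ℕ → E d → 𝕜} {g : Lp 𝕜 2 μ}
    (h : Tendsto (fun n => eLpNorm (fun x => f n x - g x) 2 μ) atTop (𝓝 0)) :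
    Tendsto (fun n => eLpNorm (fun x => L (f n x) - L.compLp g x) 2 μ) atTop (𝓝 0) := by
  have h1 : Tendsto (fun n => (‖L‖₊ : ℝ≥0∞) * eLpNorm (fun x => f n x - g x) 2 μ) atTop (𝓝 0) := by
    simpa using ENNReal.Tendsto.const_mul h (Or.inr ENNReal.coe_ne_top)
  refine tendsto_of_tendsto_of_tendsto_of_le_of_le tendsto_const_nhds h1 (fun _ => zero_le)
    fun n => ?_
  refine eLpNorm_le_nnreal_smul_eLpNorm_of_ae_le_mul ?_ 2
  filter_upwards [L.coeFn_compLp g] with x hx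
  rw [hx, ← map_sub]
  exact L.le_opNNNorm _

lemma pderiv_comp {φ : E d → 𝕜} (L : 𝕜 →L[ℝ] 𝕜') (h : ContDiff ℝ ∞ φ) (i : Fin d) (x : E d) :
    pderiv i (fun y => L (φ y)) x = L (pderiv i φ x) := by
  have := (L.hasFDerivAt.comp x (h.differentiable (by simp) x).hasFDerivAt).fderiv
  rw [pderiv]
  change fderiv ℝ (L ∘ φ) x _ = _
  rw [this]
  rfl

lemma HasTrace.map {Ω : Set (E d)} {u : H1 𝕜 Ω} {τ : L2Bdry 𝕜 Ω} (h : HasTrace u τ)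
    (L : 𝕜 →L[ℝ] 𝕜') : HasTrace (mapH1 L u) (L.compLp τ) := by
  obtain ⟨φ, hφ, h1, h2, h3⟩ := h
  refine ⟨fun n x => L (φ n x), fun n => L.contDiff.comp (hφ n), tendsto_eLpNorm_comp L h1,
    fun i => ?_, tendsto_eLpNorm_comp L h3⟩
  simp only [pderiv_comp L (hφ _)]
  exact tendsto_eLpNorm_comp L (h2 i)

/-- The pairs of smooth functions (with their derivatives) on `Ω` and their boundary values. -/
def smoothPairs (Ω : Set (E d)) : Submodule ℝ (WithLp 2 (L2Tuple ℝ Ω × L2Bdry ℝ Ω)) where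
  carrier := {z | ∃ φ : E d → ℝ, ContDiff ℝ ∞ φ ∧ z.fst none =ᵐ[volume.restrict Ω] φ ∧
    (∀ i, z.fst (some i) =ᵐ[volume.restrict Ω] pderiv i φ) ∧ z.snd =ᵐ[surf Ω] φ}
  zero_mem' := by
    refine ⟨0, contDiff_const, Lp.coeFn_zero _ _ _, fun i => ?_, Lp.coeFn_zero _ _ _⟩
    have : pderiv i (0 : E d → ℝ) = 0 := by
      funext x
      simp [pderiv]
    rw [this]
    exact Lp.coeFn_zero _ _ _
  add_mem' := by
    rintro z z' ⟨φ, hφ, h1, h2, h3⟩ ⟨φ', hφ', h1', h2', h3'⟩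
    refine ⟨φ + φ', hφ.add hφ', (Lp.coeFn_add _ _).trans (h1.add h1'), fun i => ?_,
      (Lp.coeFn_add _ _).trans (h3.add h3')⟩
    have : pderiv i (φ + φ') = pderiv i φ + pderiv i φ' := by
      funext x
      simp only [pderiv, Pi.add_apply]
      rw [fderiv_add (hφ.differentiable (by simp) x) (hφ'.differentiable (by simp) x)]
      rfl
    rw [this]
    exact (Lp.coeFn_add _ _).trans ((h2 i).add (h2' i))
  smul_mem' := by
    rintro c z ⟨φ, hφ, h1, h2, h3⟩
    refine ⟨c • φ, hφ.const_smul c, (Lp.coeFn_smul _ _).trans (h1.const_smul c), fun i => ?_,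
      (Lp.coeFn_smul _ _).trans (h3.const_smul c)⟩
    have : pderiv i (c • φ) = c • pderiv i φ := by
      funext x
      simp only [pderiv, Pi.smul_apply]
      rw [fderiv_const_smul (hφ.differentiable (by simp) x)]
      rfl
    rw [this]
    exact (Lp.coeFn_smul _ _).trans ((h2 i).const_smul c)

/-- The Hilbert space `H¹(Ω) × L²(Γ)`. -/
def PairSpace (Ω : Set (E d)) : Type := WithLp 2 (H1 ℝ Ω × L2Bdry ℝ Ω)

instance (Ω : Set (E d)) : NormedAddCommGroup (PairSpace Ω) :=
  inferInstanceAs (NormedAddCommGroup (WithLp 2 (H1 ℝ Ω × L2Bdry ℝ Ω)))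

instance (Ω : Set (E d)) : InnerProductSpace ℝ (PairSpace Ω) :=
  inferInstanceAs (InnerProductSpace ℝ (WithLp 2 (H1 ℝ Ω × L2Bdry ℝ Ω)))

instance (Ω : Set (E d)) : CompleteSpace (PairSpace Ω) :=
  inferInstanceAs (CompleteSpace (WithLp 2 (H1 ℝ Ω × L2Bdry ℝ Ω)))

/-- The projection of `H¹(Ω) × L²(Γ)` to `H¹(Ω)`. -/
def pairFst (Ω : Set (E d)) : PairSpace Ω →L[ℝ] H1 ℝ Ω :=
  WithLp.fstL 2 ℝ (H1 ℝ Ω) (L2Bdry ℝ Ω)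

/-- The projection of `H¹(Ω) × L²(Γ)` to `L²(Γ)`. -/
def pairSnd (Ω : Set (E d)) : PairSpace Ω →L[ℝ] L2Bdry ℝ Ω :=
  WithLp.sndL 2 ℝ (H1 ℝ Ω) (L2Bdry ℝ Ω)

/-- The inclusion of `H¹(Ω) × L²(Γ)` into the tuples of `L²` functions. -/
def pairInclusion (Ω : Set (E d)) :
    PairSpace Ω →L[ℝ] WithLp 2 (L2Tuple ℝ Ω × L2Bdry ℝ Ω) :=
  (WithLp.prodContinuousLinearEquiv 2 ℝ _ _).symm.toContinuousLinearMap.comp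
    (((H1 ℝ Ω).subtypeL.comp (pairFst Ω)).prod (pairSnd Ω))

/-- The graph of the trace: the closed space of all `(u, τ)` such that `τ` is a trace of `u`. -/
def traceGraph (Ω : Set (E d)) : Submodule ℝ (PairSpace Ω) :=
  (smoothPairs Ω).topologicalClosure.comap (pairInclusion Ω).toLinearMap

instance completeSpace_traceGraph (Ω : Set (E d)) : CompleteSpace (traceGraph Ω) :=
  ((smoothPairs Ω).isClosed_topologicalClosure.preimage (pairInclusion Ω).continuous).completeSpace_coe

/-- Functions which converge in `L²` are eventually representatives of elements of `L²`. -/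
lemma exists_Lp_tendsto {μ : Measure (E d)} {f : ℕ → E d → ℝ} {g : Lp ℝ 2 μ}
    (hf : ∀ n, AEStronglyMeasurable (f n) μ)
    (h : Tendsto (fun n => eLpNorm (fun x => f n x - g x) 2 μ) atTop (𝓝 0)) :
    ∃ F : ℕ → Lp ℝ 2 μ, (∀ᶠ n in atTop, F n =ᵐ[μ] f n) ∧ Tendsto F atTop (𝓝 g) := by
  classical
  have hm : ∀ᶠ n in atTop, MemLp (f n) 2 μ := by
    filter_upwards [h.eventually_lt_const ENNReal.zero_lt_top] with n hn
    have h1 : MemLp (fun x => f n x - g x) 2 μ :=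
      ⟨(hf n).sub (Lp.aestronglyMeasurable g), hn⟩
    convert h1.add (Lp.memLp g) using 1
    funext x
    simp
  set F : ℕ → Lp ℝ 2 μ := fun n => if hn : MemLp (f n) 2 μ then hn.toLp _ else 0
  have hF : ∀ᶠ n in atTop, F n =ᵐ[μ] f n := by
    filter_upwards [hm] with n hn
    simp only [F, dif_pos hn]
    exact hn.coeFn_toLp
  refine ⟨F, hF, (Lp.tendsto_Lp_iff_tendsto_eLpNorm' _ _).2 (h.congr' ?_)⟩
  filter_upwards [hF] with n hn
  refine eLpNorm_congr_ae ?_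
  filter_upwards [hn] with x hx
  simp [hx]

/-- The closure is taken among all tuples, so smooth functions need not be shown to lie in `H¹`.
`HasTrace` does not ask the approximants to be in `L²`; convergence ensures it eventually. -/
lemma mem_traceGraph {Ω : Set (E d)} {z : PairSpace Ω} :
    z ∈ traceGraph Ω ↔ HasTrace (pairFst Ω z) (pairSnd Ω z) := by
  change pairInclusion Ω z ∈ closure (smoothPairs Ω : Set _) ↔ _
  constructor
  · intro h
    obtain ⟨y, hy, hlim⟩ := mem_closure_iff_seq_limit.1 h
    choose φ hφ h1 h2 h3 using hy
    have hfst := ((WithLp.fstL 2 ℝ (L2Tuple ℝ Ω) (L2Bdry ℝ Ω)).continuous.tendsto _).comp hlim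
    have hsnd := ((WithLp.sndL 2 ℝ (L2Tuple ℝ Ω) (L2Bdry ℝ Ω)).continuous.tendsto _).comp hlim
    have hcomp : ∀ j, Tendsto (fun n => (y n).fst j) atTop (𝓝 ((pairFst Ω z : L2Tuple ℝ Ω) j)) :=
      fun j => ((PiLp.proj (𝕜 := ℝ) 2 (fun _ : Option (Fin d) => L2 ℝ Ω) j).continuous.tendsto _).comp
        hfst
    refine ⟨φ, hφ, ?_, fun i => ?_, ?_⟩
    · refine ((Lp.tendsto_Lp_iff_tendsto_eLpNorm' _ _).1 (hcomp none)).congr fun n => ?_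
      exact eLpNorm_congr_ae ((h1 n).sub (ae_eq_refl _))
    · refine ((Lp.tendsto_Lp_iff_tendsto_eLpNorm' _ _).1 (hcomp (some i))).congr fun n => ?_
      exact eLpNorm_congr_ae ((h2 n i).sub (ae_eq_refl _))
    · refine ((Lp.tendsto_Lp_iff_tendsto_eLpNorm' _ _).1 hsnd).congr fun n => ?_
      exact eLpNorm_congr_ae ((h3 n).sub (ae_eq_refl _))
  · rintro ⟨φ, hφ, h1, h2, h3⟩
    have hpd : ∀ n i, Continuous (pderiv i (φ n)) := fun n i =>
      ((hφ n).continuous_fderiv (by simp)).clm_apply continuous_const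
    obtain ⟨F, hF, hFt⟩ := exists_Lp_tendsto (fun n => (hφ n).continuous.aestronglyMeasurable) h1
    choose D hD hDt using fun i =>
      exists_Lp_tendsto (fun n => (hpd n i).aestronglyMeasurable) (h2 i)
    obtain ⟨B, hB, hBt⟩ := exists_Lp_tendsto (fun n => (hφ n).continuous.aestronglyMeasurable) h3
    refine mem_closure_of_tendsto (b := atTop) (f := fun n => WithLp.toLp 2
      ((WithLp.toLp 2 fun j : Option (Fin d) => j.elim (F n) fun i => D i n : L2Tuple ℝ Ω), B n))
      ?_ ?_
    · refine ((WithLp.prod_continuous_toLp 2 _ _).tendsto _).comp (Tendsto.prodMk_nhds ?_ hBt)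
      refine ((PiLp.continuous_toLp 2 _).tendsto _).comp (tendsto_pi_nhds.2 fun j => ?_)
      cases j with
      | none => exact hFt
      | some i => exact hDt i
    · filter_upwards [hF, hB, eventually_all.2 hD] with n hn hn' hn''
      exact ⟨φ n, hφ n, hn, hn'', hn'⟩

end Sobolev

/-! ### Real and imaginary parts of the state and adjoint problems -/

section Source

variable {d : ℕ} {Ω Ω₀ : Set (E d)}

lemma inner_Lp_real {μ : Measure (E d)} (a b : Lp ℝ 2 μ) : ⟪a, b⟫_ℝ = ∫ x, a x * b x ∂μ := by
  rw [L2.inner_def]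
  exact integral_congr_ae (Eventually.of_forall fun x => by simp [mul_comm])

lemma inner_ofReal_Lp {μ : Measure (E d)} (a : Lp ℝ 2 μ) (b : Lp ℂ 2 μ) :
    ⟪Complex.ofRealCLM.compLp a, b⟫_ℂ
      = ⟪a, Complex.reCLM.compLp b⟫_ℝ + ⟪a, Complex.imCLM.compLp b⟫_ℝ * Complex.I := by
  have hint := L2.integrable_inner (𝕜 := ℂ) (Complex.ofRealCLM.compLp a) b
  rw [L2.inner_def, inner_Lp_real, inner_Lp_real]
  apply Complex.ext
  · have := Complex.reCLM.integral_comp_comm hint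
    rw [Complex.reCLM_apply] at this
    rw [← this]
    simp only [Complex.add_re, Complex.ofReal_re, Complex.mul_re, Complex.I_re, Complex.I_im,
      Complex.ofReal_im, mul_zero, mul_one, sub_zero, add_zero]
    refine integral_congr_ae ?_
    filter_upwards [Complex.ofRealCLM.coeFn_compLp a, Complex.reCLM.coeFn_compLp b] with x h1 h2
    rw [h1, h2]
    simp [mul_comm]
  · have := Complex.imCLM.integral_comp_comm hint
    rw [Complex.imCLM_apply] at this
    rw [← this]
    simp only [Complex.add_im, Complex.ofReal_re, Complex.mul_im, Complex.I_re, Complex.I_im,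
      Complex.ofReal_im, mul_zero, mul_one, add_zero, zero_add]
    refine integral_congr_ae ?_
    filter_upwards [Complex.ofRealCLM.coeFn_compLp a, Complex.imCLM.coeFn_compLp b] with x h1 h2
    rw [h1, h2]
    simp [mul_comm]

lemma inner_ofReal_H1 (ψ : H1 ℝ Ω) (u : H1 ℂ Ω) :
    ⟪mapH1 Complex.ofRealCLM ψ, u⟫_ℂ
      = ⟪ψ, mapH1 Complex.reCLM u⟫_ℝ + ⟪ψ, mapH1 Complex.imCLM u⟫_ℝ * Complex.I := by
  simp only [Submodule.coe_inner, PiLp.inner_apply, Complex.ofReal_sum, Finset.sum_mul,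
    ← Finset.sum_add_distrib]
  exact Finset.sum_congr rfl fun j _ => inner_ofReal_Lp _ _

/-- Real test functions separate a complex problem into the two equations of `IsFormSolution`, with
`v₁ = Re u` and `v₂ = Im u`. -/
lemma form_ofReal (u : H1 ℂ Ω) (τ : L2Bdry ℂ Ω) (ψ : H1 ℝ Ω) (τψ : L2Bdry ℝ Ω) :
    form u τ (mapH1 Complex.ofRealCLM ψ) (Complex.ofRealCLM.compLp τψ)
      = ((⟪ψ, mapH1 Complex.reCLM u⟫_ℝ - ⟪τψ, Complex.imCLM.compLp τ⟫_ℝ : ℝ) : ℂ)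
        + ((⟪ψ, mapH1 Complex.imCLM u⟫_ℝ + ⟪τψ, Complex.reCLM.compLp τ⟫_ℝ : ℝ) : ℂ)
          * Complex.I := by
  have h : ∫ x, τ x * conj (Complex.ofRealCLM.compLp τψ x) ∂(surf Ω)
      = ⟪Complex.ofRealCLM.compLp τψ, τ⟫_ℂ := by
    rw [L2.inner_def]
    rfl
  rw [form, h, inner_ofReal_H1, inner_ofReal_Lp]
  push_cast
  linear_combination (⟪τψ, Complex.imCLM.compLp τ⟫_ℝ : ℂ) * Complex.I_mul_I

/-- Two measures occur because the source is integrated over `Ω₀`, while the test function is a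
class on `Ω`. -/
lemma integral_ofReal_mul_conj {μ ν : Measure (E d)} (hν : ν ≤ μ) (f : E d → ℝ) (a : Lp ℝ 2 μ) :
    ∫ x, (f x : ℂ) * conj (Complex.ofRealCLM.compLp a x) ∂ν = ((∫ x, f x * a x ∂ν : ℝ) : ℂ) := by
  rw [← integral_complex_ofReal]
  refine integral_congr_ae ?_
  filter_upwards [ae_mono hν (Complex.ofRealCLM.coeFn_compLp a)] with x hx
  rw [hx]
  simp

/-- The function, as a continuous linear map on the graph of the trace. -/
def graphFn (Ω : Set (E d)) : traceGraph Ω →L[ℝ] H1 ℝ Ω :=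
  (pairFst Ω).comp (traceGraph Ω).subtypeL

/-- The trace, as a continuous linear map on the graph of the trace. -/
def graphTrace (Ω : Set (E d)) : traceGraph Ω →L[ℝ] L2Bdry ℝ Ω :=
  (pairSnd Ω).comp (traceGraph Ω).subtypeL

/-- The element of the graph given by a function and its trace. -/
def graphMk {u : H1 ℝ Ω} {τ : L2Bdry ℝ Ω} (h : HasTrace u τ) : traceGraph Ω :=
  ⟨WithLp.toLp 2 (u, τ), mem_traceGraph.2 h⟩

@[simp] lemma graphFn_mk {u : H1 ℝ Ω} {τ : L2Bdry ℝ Ω} (h : HasTrace u τ) :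
    graphFn Ω (graphMk h) = u := rfl

@[simp] lemma graphTrace_mk {u : H1 ℝ Ω} {τ : L2Bdry ℝ Ω} (h : HasTrace u τ) :
    graphTrace Ω (graphMk h) = τ := rfl

lemma hasTrace_graph (k : traceGraph Ω) : HasTrace (graphFn Ω k) (graphTrace Ω k) :=
  mem_traceGraph.1 k.2

lemma inner_graph (h k : traceGraph Ω) :
    ⟪h, k⟫_ℝ = ⟪graphFn Ω h, graphFn Ω k⟫_ℝ + ⟪graphTrace Ω h, graphTrace Ω k⟫_ℝ :=
  WithLp.prod_inner_apply _ _

/-- `v₁ + i v₂` solves `(v, k)_{H¹(Ω)} + i (v, k)_{L²(Γ)} = (F, k)` for all `k` in the graph of the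
trace. -/
abbrev IsMixedSolution (F v₁ v₂ : traceGraph Ω) : Prop :=
  IsFormSolution (graphFn Ω) (graphTrace Ω) F v₁ v₂

/-- Restriction of `L²` functions to a subset. -/
def restrictL2 (h : Ω₀ ⊆ Ω) : L2 ℝ Ω →L[ℝ] L2 ℝ Ω₀ :=
  have hμ : (volume : Measure (E d)).restrict Ω₀ ≤ volume.restrict Ω := Measure.restrict_mono_set _ h
  LinearMap.mkContinuous
    { toFun := fun f => ((Lp.memLp f).mono_measure hμ).toLp f
      map_add' := fun f g => by
        rw [← MemLp.toLp_add]
        exact MemLp.toLp_congr _ _ (ae_mono hμ (Lp.coeFn_add f g))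
      map_smul' := fun a f => by
        rw [RingHom.id_apply, ← MemLp.toLp_const_smul]
        exact MemLp.toLp_congr _ _ (ae_mono hμ (Lp.coeFn_smul a f)) } 1 fun f => by
    rw [one_mul]
    change ‖((Lp.memLp f).mono_measure hμ).toLp f‖ ≤ ‖f‖
    rw [Lp.norm_toLp, Lp.norm_def]
    exact ENNReal.toReal_mono (Lp.eLpNorm_ne_top f) (eLpNorm_mono_measure _ hμ)

lemma coeFn_restrictL2 (h : Ω₀ ⊆ Ω) (f : L2 ℝ Ω) :
    restrictL2 h f =ᵐ[volume.restrict Ω₀] f :=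
  MemLp.coeFn_toLp ((Lp.memLp f).mono_measure (Measure.restrict_mono_set _ h))

lemma inner_restrictL2 (h : Ω₀ ⊆ Ω) (p : L2 ℝ Ω₀) (f : L2 ℝ Ω) :
    ⟪p, restrictL2 h f⟫_ℝ = ∫ x in Ω₀, p x * f x := by
  rw [inner_Lp_real]
  refine integral_congr_ae ?_
  filter_upwards [coeFn_restrictL2 h f] with x hx
  rw [hx]

/-- The `L²` function underlying an element of the graph of the trace. -/
def graphL2 (Ω : Set (E d)) : traceGraph Ω →L[ℝ] L2 ℝ Ω := (fnL ℝ Ω).comp (graphFn Ω)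

lemma graphL2_apply (k : traceGraph Ω) : graphL2 Ω k = fn (graphFn Ω k) := rfl

/-- The functional `k ↦ ∫_{Ω₀} p k dx` on the graph of the trace. -/
def sourceL (h : Ω₀ ⊆ Ω) : L2 ℝ Ω₀ →L[ℝ] traceGraph Ω :=
  (restrictL2 h ∘L graphL2 Ω).adjoint

lemma inner_sourceL (h : Ω₀ ⊆ Ω) (p : L2 ℝ Ω₀) (k : traceGraph Ω) :
    ⟪sourceL h p, k⟫_ℝ = ∫ x in Ω₀, p x * fn (graphFn Ω k) x := by
  rw [sourceL, ContinuousLinearMap.adjoint_inner_left, ← inner_restrictL2 h]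
  rfl

variable {g₁ g₂ : E d → ℝ}

/-- The difference of a state and an exact solution solves a mixed problem. -/
lemma IsState.exists_isMixedSolution (h : Ω₀ ⊆ Ω) {p₀ p : L2 ℝ Ω₀} {u : H1 ℂ Ω}
    (hp₀ : IsExactSource Ω Ω₀ g₁ g₂ p₀) (hu : IsState Ω Ω₀ g₁ g₂ p u) :
    ∃ v₁ v₂ : traceGraph Ω, IsMixedSolution (sourceL h (p - p₀)) v₁ v₂ ∧
      graphL2 Ω v₂ = Complex.imCLM.compLp (fn u) := by
  obtain ⟨u₀, τ₀, ht₀, hg, he⟩ := hp₀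
  obtain ⟨τ, ht, hs⟩ := hu
  have key : ∀ k : traceGraph Ω,
      ⟪graphFn Ω k, mapH1 Complex.reCLM u⟫_ℝ - ⟪graphTrace Ω k, Complex.imCLM.compLp τ⟫_ℝ
        = (∫ x in Ω₀, p x * fn (graphFn Ω k) x) + ∫ x, g₂ x * graphTrace Ω k x ∂(surf Ω) ∧
      ⟪graphFn Ω k, mapH1 Complex.imCLM u⟫_ℝ + ⟪graphTrace Ω k, Complex.reCLM.compLp τ⟫_ℝ
        = ⟪τ₀, graphTrace Ω k⟫_ℝ := by
    intro k
    have hk := hs _ _ ((hasTrace_graph k).map Complex.ofRealCLM)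
    have h1 : ∫ x, g₁ x * graphTrace Ω k x ∂(surf Ω) = ⟪τ₀, graphTrace Ω k⟫_ℝ := by
      rw [inner_Lp_real]
      refine integral_congr_ae ?_
      filter_upwards [hg] with x hx
      rw [hx]
    rw [form_ofReal, fn_mapH1, integral_ofReal_mul_conj (Measure.restrict_mono_set _ h),
      integral_ofReal_mul_conj le_rfl, integral_ofReal_mul_conj le_rfl, h1] at hk
    constructor
    · simpa using congrArg Complex.re hk
    · simpa using congrArg Complex.im hk
  -- Subtracting the exact solution from the real part removes `g₂` from the first equation and,
  -- through its trace `τ₀ = g₁`, `g₁` from the second.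
  refine ⟨graphMk (ht.map Complex.reCLM) - graphMk ht₀, graphMk (ht.map Complex.imCLM),
    ⟨fun k => ?_, fun k => ?_⟩, rfl⟩
  · have h1 := (key k).1
    have h2 := he _ _ (hasTrace_graph k)
    rw [map_sub (sourceL h), inner_sub_left, inner_sourceL, inner_sourceL, map_sub, inner_sub_left]
    simp only [graphFn_mk, graphTrace_mk]
    rw [real_inner_comm _ (mapH1 _ _), real_inner_comm _ (Complex.imCLM.compLp τ), h2]
    linarith
  · have h1 := (key k).2
    rw [map_sub, inner_sub_left]
    simp only [graphFn_mk, graphTrace_mk]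
    rw [real_inner_comm _ (mapH1 _ _), real_inner_comm _ (Complex.reCLM.compLp τ)]
    linarith

/-- An adjoint state solves a mixed problem. -/
lemma IsAdjoint.exists_isMixedSolution {u w : H1 ℂ Ω} (hw : IsAdjoint Ω u w) :
    ∃ w₁ w₂ : traceGraph Ω,
      IsMixedSolution ((graphL2 Ω).adjoint (Complex.imCLM.compLp (fn u))) w₁ w₂ ∧
      graphL2 Ω w₂ = Complex.imCLM.compLp (fn w) := by
  obtain ⟨τ, ht, hs⟩ := hw
  have key : ∀ k : traceGraph Ω,
      ⟪graphFn Ω k, mapH1 Complex.reCLM w⟫_ℝ - ⟪graphTrace Ω k, Complex.imCLM.compLp τ⟫_ℝ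
        = ⟪Complex.imCLM.compLp (fn u), graphL2 Ω k⟫_ℝ ∧
      ⟪graphFn Ω k, mapH1 Complex.imCLM w⟫_ℝ + ⟪graphTrace Ω k, Complex.reCLM.compLp τ⟫_ℝ = 0 := by
    intro k
    have hk := hs _ _ ((hasTrace_graph k).map Complex.ofRealCLM)
    have h1 : ∫ x in Ω, (fn u x).im * fn (graphFn Ω k) x
        = ⟪Complex.imCLM.compLp (fn u), graphL2 Ω k⟫_ℝ := by
      rw [inner_Lp_real]
      refine integral_congr_ae ?_
      filter_upwards [Complex.imCLM.coeFn_compLp (fn u)] with x hx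
      rw [hx]
      rfl
    rw [form_ofReal, fn_mapH1, integral_ofReal_mul_conj le_rfl, h1] at hk
    constructor
    · simpa using congrArg Complex.re hk
    · simpa using congrArg Complex.im hk
  refine ⟨graphMk (ht.map Complex.reCLM), graphMk (ht.map Complex.imCLM),
    ⟨fun k => ?_, fun k => ?_⟩, rfl⟩
  · rw [ContinuousLinearMap.adjoint_inner_left, ← (key k).1]
    simp only [graphFn_mk, graphTrace_mk]
    rw [real_inner_comm, real_inner_comm (graphTrace Ω k)]
  · rw [← (key k).2]
    simp only [graphFn_mk, graphTrace_mk]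
    rw [real_inner_comm, real_inner_comm (graphTrace Ω k)]

/-- If the second component of the solution of the mixed problem vanishes in `Ω`, the source can be
added to an exact source. -/
lemma IsExactSource.add (h : Ω₀ ⊆ Ω) (hΩ : IsOpen Ω) {p q : L2 ℝ Ω₀} {v₁ v₂ : traceGraph Ω}
    (hp : IsExactSource Ω Ω₀ g₁ g₂ p) (hv : IsMixedSolution (sourceL h q) v₁ v₂)
    (h0 : graphL2 Ω v₂ = 0) : IsExactSource Ω Ω₀ g₁ g₂ (p + q) := by
  obtain ⟨u, τ, ht, hg, he⟩ := hp
  obtain ⟨hv1, hv2⟩ := hv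
  have hv₂ : graphFn Ω v₂ = 0 := eq_zero_of_fn_eq_zero hΩ h0
  have ht₁ : graphTrace Ω v₁ = 0 := by
    have := hv2 v₁
    rwa [hv₂, inner_zero_left, zero_add, inner_self_eq_zero] at this
  -- Uniqueness of traces is not available here, so `v₂ = 0` in `H¹` does not settle its trace;
  -- testing the first equation with `v₂` does.
  have ht₂ : graphTrace Ω v₂ = 0 := by
    have := hv1 v₂
    rw [sourceL, ContinuousLinearMap.adjoint_inner_left, ContinuousLinearMap.comp_apply, h0,
      map_zero, hv₂, inner_zero_right, inner_zero_right, zero_sub, neg_eq_zero] at this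
    exact inner_self_eq_zero.1 this
  have hsum := hasTrace_graph (graphMk ht + v₁)
  rw [map_add, map_add, graphFn_mk, graphTrace_mk, ht₁, add_zero] at hsum
  refine ⟨u + graphFn Ω v₁, τ, hsum, hg, fun ψ τψ hψ => ?_⟩
  have h1 := hv1 (graphMk hψ)
  have h2 : ∫ x in Ω₀, (p + q) x * fn ψ x
      = ⟪sourceL h p, graphMk hψ⟫_ℝ + ⟪sourceL h q, graphMk hψ⟫_ℝ := by
    rw [← inner_add_left, ← map_add, inner_sourceL, graphFn_mk]
  rw [ht₂, inner_zero_left, sub_zero, graphFn_mk] at h1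
  rw [h2, inner_add_left, he ψ τψ hψ, inner_sourceL, graphFn_mk, h1]
  ring

variable {P : Type*} [NormedAddCommGroup P] [InnerProductSpace ℝ P] [CompleteSpace P]

/-- Weak convergence of the flow to an exact source, for a Hilbert space `P` of sources. -/
theorem exists_weak_limit_of_isNesterovFlow (h : Ω₀ ⊆ Ω) (hΩ : IsOpen Ω) {r : ℝ} (hr : 3 < r)
    (ι : P →L[ℝ] L2 ℝ Ω₀) (hex : ∃ p : P, IsExactSource Ω Ω₀ g₁ g₂ (ι p)) {p₀ p₁ : P} {p : ℝ → P}
    (hp : IsNesterovFlow Ω Ω₀ g₁ g₂ r ι p₀ p₁ p) :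
    ∃ pbar : P, IsExactSource Ω Ω₀ g₁ g₂ (ι pbar) ∧
      ∀ q : P, Tendsto (fun t => ⟪p t, q⟫_ℝ) atTop (𝓝 ⟪pbar, q⟫_ℝ) := by
  obtain ⟨ps, hps⟩ := hex
  obtain ⟨p', p'', G, u, w, hpc, hpc', -, -, hflow⟩ := hp
  obtain ⟨M, hM, hMex, hMuniq⟩ := exists_formSolutionOperator (graphFn Ω) (graphTrace Ω)
    (inner_graph (Ω := Ω))
  set A : P →L[ℝ] L2 ℝ Ω := graphL2 Ω ∘L M ∘L sourceL h ∘L ι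
  have hA : ∀ q, A q = graphL2 Ω (M (sourceL h (ι q))) := fun q => rfl
  -- Self-adjointness of `M` moves it from the source `q` onto the right-hand side of the adjoint
  -- problem, which produces `Im w`.
  have hG : ∀ t, 1 < t → A.adjoint (A (p t - ps)) = G t := by
    intro t ht
    obtain ⟨-, -, -, hGt, hu, hw⟩ := hflow t ht
    refine ext_inner_right ℝ fun q => ?_
    obtain ⟨v₁, v₂, hv, hvu⟩ := hu.exists_isMixedSolution h hps
    obtain ⟨w₁, w₂, hw, hww⟩ := hw.exists_isMixedSolution
    have e1 : ∫ x in Ω₀, (fn (w t) x).im * ι q x = ⟪sourceL h (ι q), w₂⟫_ℝ := by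
      rw [inner_sourceL, ← graphL2_apply, hww]
      refine integral_congr_ae ?_
      filter_upwards [ae_mono (Measure.restrict_mono_set _ h)
        (Complex.imCLM.coeFn_compLp (fn (w t)))] with x hx
      rw [hx, mul_comm]
      rfl
    rw [hGt q, e1, hMuniq _ _ _ hw, ContinuousLinearMap.adjoint_inner_left, hA, hA, map_sub ι,
      ← hMuniq _ _ _ hv, hvu, ← hM, ContinuousLinearMap.adjoint_inner_right, real_inner_comm]
  have hdamped : IsDampedFlow A r (fun t => p t - ps) p' p'' :=
    ⟨hpc.sub continuousOn_const, hpc', fun t ht => (hflow t ht).1.sub_const ps,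
      fun t ht => (hflow t ht).2.1, fun t ht => by rw [hG t ht]; exact (hflow t ht).2.2.1⟩
  obtain ⟨l, hl0, hl⟩ := hdamped.exists_weak_limit hr
  obtain ⟨v, hv⟩ := hMex (sourceL h (ι l))
  refine ⟨ps + l, ?_, fun q => ?_⟩
  · rw [map_add]
    exact hps.add h hΩ hv hl0
  · have := (hl q).const_add ⟪ps, q⟫_ℝ
    rw [← inner_add_left] at this
    refine this.congr fun t => ?_
    rw [← inner_add_left, add_sub_cancel]

end Source

end InverseSource

end

/-! ### The two source spaces -/

theorem theorem3p7 (d : ℕ) (hd : d = 2 ∨ d = 3)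
    (Ω Ω₀ : Set (InverseSource.E d)) (hΩ : InverseSource.IsSmoothBoundedDomain Ω)
    (hΩ₀ : IsOpen Ω₀) (hsub : Ω₀ ⊆ Ω)
    (g₁ g₂ : InverseSource.E d → ℝ)
    (hg₁ : MemLp g₁ ∞ (InverseSource.surf Ω)) (hg₂ : MemLp g₂ ∞ (InverseSource.surf Ω))
    (r : ℝ) (hr : 3 < r) :
    -- the source space `P = L²(Ω₀)`
    ((∃ p : InverseSource.L2 ℝ Ω₀, InverseSource.IsExactSource Ω Ω₀ g₁ g₂ p) →
      ∀ (p₀ p₁ : InverseSource.L2 ℝ Ω₀) (p : ℝ → InverseSource.L2 ℝ Ω₀),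
        InverseSource.IsNesterovFlow Ω Ω₀ g₁ g₂ r id p₀ p₁ p →
        ∃ pbar : InverseSource.L2 ℝ Ω₀, InverseSource.IsExactSource Ω Ω₀ g₁ g₂ pbar ∧
          ∀ q : InverseSource.L2 ℝ Ω₀, Tendsto (fun t => ⟪p t, q⟫_ℝ) atTop (𝓝 ⟪pbar, q⟫_ℝ)) ∧
    -- the source space `P = H¹(Ω₀)`
    ((∃ p : InverseSource.H1 ℝ Ω₀, InverseSource.IsExactSource Ω Ω₀ g₁ g₂ (InverseSource.fn p)) →
      ∀ (p₀ p₁ : InverseSource.H1 ℝ Ω₀) (p : ℝ → InverseSource.H1 ℝ Ω₀),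
        InverseSource.IsNesterovFlow Ω Ω₀ g₁ g₂ r InverseSource.fn p₀ p₁ p →
        ∃ pbar : InverseSource.H1 ℝ Ω₀, InverseSource.IsExactSource Ω Ω₀ g₁ g₂ (InverseSource.fn pbar) ∧
          ∀ q : InverseSource.H1 ℝ Ω₀, Tendsto (fun t => ⟪p t, q⟫_ℝ) atTop (𝓝 ⟪pbar, q⟫_ℝ)) := by
  rcases hΩ with ⟨hΩ, -, -, -⟩
  -- The cases differ only in the bounded inclusion of `P` into `L²(Ω₀)`.
  exact ⟨fun hex _ _ _ hp => InverseSource.exists_weak_limit_of_isNesterovFlow hsub hΩ hr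
      (ContinuousLinearMap.id ℝ _) hex hp,
    fun hex _ _ _ hp => InverseSource.exists_weak_limit_of_isNesterovFlow hsub hΩ hr
      (InverseSource.fnL ℝ Ω₀) hex hp⟩
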